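/- Let $G$ be a bounded abelian group, i.e. $nG=\{0\}$ for some integer $n\ge 1$. Then $G$ has a decomposition $$G\cong\bigoplus_{p\in\pi}\ \bigoplus_{i=1}^{m_p}\mathbb{Z}(p^i)^{(\alpha_{p,i})},\qquad (*)$$ where $\pi$ is a finite set of primes (empty if $G$ is trivial), $\mathbb{Z}(p^i)$ is the cyclic group of order $p^i$, $m_p\ge 1$, and the $\alpha_{p,i}$ are cardinals (the Ulm–Kaplansky invariants of $G$) with $\alpha_{p,m_p}>0$ for every $p\in\pi$; the cardinals $\alpha_{p,m_p}$, $p\in\pi$, are called the leading Ulm–Kaplansky invariants of $G$. For every decomposition $(*)$ of $G$ the following conditions are equivalent: (a) $G$ admits a minimally almost periodic group topology, i.e. a Hausdorff group topology for which every continuous homomorphism $G\to\mathbb{T}=\mathbb{R}/\mathbb{Z}$ is trivial; (b) $G$ is Zariski-connected, i.e. $G$ is connected in its Zariski topology, the topology whose closed sets are the intersections of finite unions of solution sets $\{x\in G: a_1+n_1x+\dots+a_k+n_kx=0\}$ with $a_j\in G$, $n_j\in\mathbb{Z}$; (c) all leading Ulm–Kaplansky invariants $\alpha_{p,m_p}$,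 $p\in\pi$, are infinite. -/

import Mathlib

open scoped DirectSum

universe u

/-- A topological abelian group is minimally almost periodic if every continuous homomorphism
(character) to the circle group `𝕋 = ℝ / ℤ` is trivial. -/
def IsMinAP (G : Type u) [AddCommGroup G] [TopologicalSpace G] : Prop :=
  ∀ χ : G →+ UnitAddCircle, Continuous χ → χ = 0

/-- `G` admits a minimally almost periodic Hausdorff group topology. -/
def AdmitsMinAPGroupTopology (G : Type u) [AddCommGroup G] : Prop :=
  ∃ τ : TopologicalSpace G,
    @IsTopologicalAddGroup G τ _ ∧ @T2Space G τ ∧ @IsMinAP G _ τ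

/-- A subset of a group (written additively, not necessarily commutative) is elementary algebraic
if it is the solution set of one equation `a₁ + n₁ x + a₂ + n₂ x + ⋯ + aₖ + nₖ x = 0` in one
variable, with constants `aᵢ` in the group and integers `nᵢ`. -/
def IsElementaryAlgebraic {G : Type u} [AddGroup G] (A : Set G) : Prop :=
  ∃ w : List (G × ℤ), A = {x : G | (w.map fun t => t.1 + t.2 • x).sum = 0}

/-- The Zariski topology of a group: the topology for which the elementary algebraic sets form a
subbase of closed sets, so that its closed sets are exactly the algebraic sets, that is, the
intersections of finite unions of elementary algebraic sets. -/
@[reducible] def zariskiTopology (G : Type u) [AddGroup G] : TopologicalSpace G :=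
  TopologicalSpace.generateFrom {U : Set G | IsElementaryAlgebraic Uᶜ}

/-- A group is Zariski-connected if it is connected in its Zariski topology. -/
def IsZariskiConnected (G : Type u) [AddGroup G] : Prop :=
  @ConnectedSpace G (zariskiTopology G)

/-- A decomposition `G ≅ ⨁_{p ∈ π} ⨁_{i = 1}^{m_p} ℤ(p^i)^{(α_{p,i})}` of an abelian group, with
`π` a finite set of primes, `m_p ≥ 1` and `α_{p,m_p} > 0` for `p ∈ π`; the cardinal `α_{p,i}` is
given by an index set `index p i`. (The trivial group has the decomposition with `π = ∅`.) -/
structure UlmKaplanskyDecomposition (G : Type u) [AddCommGroup G] where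
  /-- the set `π` -/
  primes : Finset ℕ
  prime_of_mem : ∀ p ∈ primes, p.Prime
  /-- the exponents `m_p` -/
  top : ℕ → ℕ
  one_le_top : ∀ p ∈ primes, 1 ≤ top p
  /-- the index set of the summands `ℤ(p^i)` -/
  index : ℕ → ℕ → Type u
  nonempty_index_top : ∀ p ∈ primes, Nonempty (index p (top p))
  /-- the isomorphism -/
  equiv : G ≃+ ⨁ p : primes, ⨁ i : Finset.Icc 1 (top p),
    (index p i →₀ ZMod ((p : ℕ) ^ (i : ℕ)))

namespace UlmKaplanskyDecomposition

/-- The Ulm–Kaplansky invariant `α_{p,i}`. -/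
def invariant {G : Type u} [AddCommGroup G] (D : UlmKaplanskyDecomposition G) (p i : ℕ) :
    Cardinal.{u} :=
  Cardinal.mk (D.index p i)

/-- The leading Ulm–Kaplansky invariant `α_{p,m_p}`, for `p ∈ π`. -/
def leadingInvariant {G : Type u} [AddCommGroup G] (D : UlmKaplanskyDecomposition G) (p : ℕ) :
    Cardinal.{u} :=
  D.invariant p (D.top p)

end UlmKaplanskyDecomposition

/-! The decomposition is Prüfer's: if `p ^ (m + 1)` is the exact power of `p` in the exponent `n`,
then `ℤ/p^(m+1)` is injective over `ℤ/n`, so a maximal sum of its copies splits off; the complement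
is killed by `n / p`, and induction applies.

(c) ⇒ (a): the finitely supported `M`-valued step functions on `[0, ∞)` with rational jumps, normed
by the measure of the support, form a sum of countably many copies of `M`. Elements of small norm
generate, while characters of a bounded group take finitely many values, so continuous characters
vanish. This covers sums in which each order occurs infinitely often; `G` is a quotient of such a
sum by a finite kernel.

(a) ⇒ (b) ⇒ (c) pass through `MultiplesTrivialOrInfinite`. If `nG` is finite and nonzero, the
`n`-torsion is a proper clopen subgroup, both in a Hausdorff group topology and in the Zariski
topology. If no such `n` exists, proper elementary algebraic sets lie in cosets of infinite index,
and Neumann's covering lemma makes `G` irreducible. A finite leading invariant yields a finite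
nonzero multiple of `G`. -/

/-! ### Decomposition of bounded groups into cyclic groups -/

/-- Arithmetic form of the injectivity of `ℤ/q` over `ℤ/qk`. Taking `c = qk / gcd(d, qk)` gives
`gcd(d, q) ∣ k * z`; coprimality removes `k`, and Bézout concludes. -/
theorem Int.exists_eq_mul_add_mul_of_annihilator {q k : ℕ} (hqk : q.Coprime k) (hq : q ≠ 0) (hk : k ≠ 0)
    (d z : ℤ)
    (h : ∀ c : ℤ, ((q * k : ℕ) : ℤ) ∣ c * d → (q : ℤ) ∣ c * z) : ∃ u v : ℤ, z = d * u + q * v := by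
  set n : ℤ := ((q * k : ℕ) : ℤ) with hn
  have hn0 : n ≠ 0 := by simp [hn, hq, hk]
  obtain ⟨c, hc⟩ : (Int.gcd d n : ℤ) ∣ n := Int.gcd_dvd_right ..
  obtain ⟨d', hd'⟩ : (Int.gcd d n : ℤ) ∣ d := Int.gcd_dvd_left ..
  have h1 : (q : ℤ) ∣ c * z := by
    apply h
    refine ⟨d', ?_⟩
    linear_combination c * hd' - d' * hc
  have h2 : (Int.gcd d n : ℤ) ∣ k * z := by
    obtain ⟨w, hw⟩ := h1
    have hc0 : c ≠ 0 := by rintro rfl; simp [hn0] at hc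
    refine ⟨w, ?_⟩
    apply mul_left_cancel₀ hc0
    calc c * (k * z) = k * (c * z) := by ring
      _ = n * w := by rw [hw, hn]; push_cast; ring
      _ = c * ((Int.gcd d n : ℤ) * w) := by linear_combination w * hc
  have h3 : (Int.gcd d q : ℤ) ∣ k * z :=
    (Int.natCast_dvd_natCast.2 (by simpa [hn] using Int.gcd_dvd_gcd_mul_right_right d q k)).trans h2
  have h4 : (Int.gcd d q : ℤ) ∣ z := by
    refine IsCoprime.dvd_of_dvd_mul_left ?_ h3
    have : IsCoprime (q : ℤ) (k : ℤ) := Nat.isCoprime_iff_coprime.2 hqk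
    exact this.of_isCoprime_of_dvd_left (Int.gcd_dvd_right ..)
  obtain ⟨w, hw⟩ := h4
  refine ⟨Int.gcdA d q * w, Int.gcdB d q * w, ?_⟩
  rw [hw, Int.gcd_eq_gcd_ab]
  ring

/-- An injective homomorphism into a group of exponent `n` splits as soon as its domain `H` is
divisible in the sense of Baer's criterion over `ℤ / n`. -/
theorem exists_leftInverse_of_baer {n : ℕ} {H G : Type*} [AddCommGroup H] [AddCommGroup G]
    (hH : ∀ h : H, n • h = 0) (hG : ∀ g : G, n • g = 0)
    (hdiv : ∀ (d : ℤ) (x : H), (∀ c : ℤ, (n : ℤ) ∣ c * d → c • x = 0) → ∃ y, d • y = x)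
    (ι : H →+ G) (hι : Function.Injective ι) : ∃ r : G →+ H, ∀ h, r (ι h) = h := by
  obtain ⟨_⟩ : Nonempty (Module (ZMod n) G) := ⟨AddCommGroup.zmodModule hG⟩
  obtain ⟨_⟩ : Nonempty (Module (ZMod n) H) := ⟨AddCommGroup.zmodModule hH⟩
  have baer : Module.Baer (ZMod n) H := by
    intro I g
    -- Ideals of `ℤ/n` are principal, so extending `g` only requires dividing its value at a
    -- generator `d` by `d`.
    have : IsPrincipalIdealRing (ZMod n) :=
      IsPrincipalIdealRing.of_surjective (Int.castRingHom (ZMod n)) (ZMod.ringHom_surjective _)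
    obtain ⟨d0, hd0⟩ := (IsPrincipalIdealRing.principal I).principal
    obtain ⟨d, rfl⟩ := ZMod.intCast_surjective d0
    have hdI : ((d : ZMod n)) ∈ I := by rw [hd0]; exact Submodule.mem_span_singleton_self _
    obtain ⟨y, hy⟩ := hdiv d (g ⟨_, hdI⟩) (by
      intro c hc
      rw [← Int.cast_smul_eq_zsmul (ZMod n), ← map_smul]
      convert map_zero g
      ext
      simp only [SetLike.mk_smul_mk, smul_eq_mul]
      rw [← Int.cast_mul, (ZMod.intCast_zmod_eq_zero_iff_dvd _ _).2 hc]; rfl)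
    refine ⟨LinearMap.toSpanSingleton _ _ y, fun x hx => ?_⟩
    obtain ⟨a, rfl⟩ := Submodule.mem_span_singleton.1 (hd0 ▸ hx)
    have : (⟨a • (d : ZMod n), hx⟩ : I) = a • ⟨_, hdI⟩ := rfl
    rw [this, map_smul, map_smul, LinearMap.toSpanSingleton_apply, Int.cast_smul_eq_zsmul, hy]
  obtain ⟨r, hr⟩ := baer.extension_property (ι.toZModLinearMap n) hι LinearMap.id
  exact ⟨r.toAddMonoidHom, fun h => DFunLike.congr_fun hr h⟩

theorem exists_leftInverse_of_injective_of_coprime {n q k : ℕ} (hn : n = q * k) (hqk : q.Coprime k)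
    (hn0 : n ≠ 0) {G : Type*} [AddCommGroup G] (hG : ∀ g : G, n • g = 0) {J : Type*}
    (ι : (J →₀ ZMod q) →+ G) (hι : Function.Injective ι) :
    ∃ r : G →+ (J →₀ ZMod q), ∀ h, r (ι h) = h := by
  have hq : q ≠ 0 := by rintro rfl; simp at hn; exact hn0 hn
  have hk : k ≠ 0 := by rintro rfl; simp at hn; exact hn0 hn
  refine exists_leftInverse_of_baer (fun h => by ext j; simp [hn]) hG (fun d h hann => ?_) ι hι
  have hdiv : ∀ j, ∃ u : ZMod q, h j = d * u := by
    intro j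
    obtain ⟨z, hz⟩ := ZMod.intCast_surjective (h j)
    obtain ⟨u, v, huv⟩ := Int.exists_eq_mul_add_mul_of_annihilator hqk hq hk d z (by
      intro c hc
      rw [← hn] at hc
      have := DFunLike.congr_fun (hann c hc) j
      simp only [Finsupp.coe_smul, Pi.smul_apply, Finsupp.coe_zero, Pi.zero_apply] at this
      rw [← hz, zsmul_eq_mul, ← Int.cast_mul] at this
      exact (ZMod.intCast_zmod_eq_zero_iff_dvd _ _).1 this)
    exact ⟨u, by rw [← hz, huv]; simp⟩
  choose u hu using hdiv
  -- Coordinatewise quotients are reset to `0` off the support of `h`, to keep the support finite.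
  refine ⟨Finsupp.onFinset h.support (fun j => if h j = 0 then 0 else u j)
    (by intro j; simp; tauto), ?_⟩
  ext j
  simp only [Finsupp.coe_smul, Pi.smul_apply, Finsupp.onFinset_apply, zsmul_eq_mul]
  split_ifs with h0
  · simp [h0]
  · rw [← hu]

/-- Elements `x j` of order dividing `p ^ m` whose multiples `p ^ (m - 1) • x j` are independent
over `ℤ / p` generate a direct sum of cyclic groups of order `p ^ m`. -/
theorem injective_of_linearIndependent_socle {p m : ℕ} (hp : p.Prime) {G : Type*}
    [AddCommGroup G] {J : Type*} (ι : (J →₀ ZMod (p ^ (m + 1))) →+ G)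
    (h : ∀ f : J →₀ ℤ, (f.sum fun j a => a • p ^ m • ι (Finsupp.single j 1)) = 0 →
      ∀ j, (p : ℤ) ∣ f j) :
    Function.Injective ι := by
  rw [injective_iff_map_eq_zero]
  -- On the `p`-torsion `f = p ^ m • F` for an integral `F`, which is where independence applies;
  -- `key2` reduces any element to this case.
  have key : ∀ f, p • f = 0 → ι f = 0 → f = 0 := by
    intro f hpf hf
    have hdvd : ∀ j, ∃ z : ℤ, f j = ((p ^ m * z : ℤ) : ZMod (p ^ (m + 1))) := by
      intro j
      obtain ⟨z, hz⟩ := ZMod.intCast_surjective (f j)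
      have h1 := DFunLike.congr_fun hpf j
      simp only [Finsupp.coe_smul, Pi.smul_apply, Finsupp.coe_zero, Pi.zero_apply] at h1
      rw [← hz, nsmul_eq_mul] at h1
      have h2 : ((p ^ (m + 1) : ℕ) : ℤ) ∣ p * z := by
        rw [← ZMod.intCast_zmod_eq_zero_iff_dvd]; push_cast; exact h1
      obtain ⟨w, hw⟩ := h2
      refine ⟨w, ?_⟩
      rw [← hz]
      congr 1
      have : (p : ℤ) ≠ 0 := by exact_mod_cast hp.ne_zero
      apply mul_left_cancel₀ this
      rw [hw]; push_cast; ring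
    choose z hz using hdvd
    let F : J →₀ ℤ := Finsupp.onFinset f.support (fun j => if f j = 0 then 0 else z j)
      (by intro j; simp; tauto)
    have hF : ∀ j, f j = ((p ^ m * F j : ℤ) : ZMod (p ^ (m + 1))) := by
      intro j
      simp only [F, Finsupp.onFinset_apply]
      split_ifs with h0
      · simp [h0]
      · exact hz j
    have hfF : f = F.sum fun j a => a • p ^ m • Finsupp.single j 1 := by
      ext i
      rw [Finsupp.sum_apply, Finsupp.sum_eq_single i]
      · simp [hF i, mul_comm]
      · intro j _ hj; simp [hj]
      · simp
    have h0 : ∀ j, (p : ℤ) ∣ F j := by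
      apply h
      rw [← hf]
      conv_rhs => rw [hfF]
      rw [map_finsuppSum]
      simp only [map_zsmul, map_nsmul]
    ext j
    rw [hF j, Finsupp.coe_zero, Pi.zero_apply, ZMod.intCast_zmod_eq_zero_iff_dvd]
    obtain ⟨w, hw⟩ := h0 j
    exact ⟨w, by rw [hw]; push_cast; ring⟩
  have key2 : ∀ t, ∀ f, p ^ t • f = 0 → ι f = 0 → f = 0 := by
    intro t
    induction t with
    | zero => intro f hf _; simpa using hf
    | succ t ih =>
      intro f hf hιf
      refine key f (ih _ ?_ (by rw [map_nsmul, hιf, smul_zero])) hιf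
      rw [← mul_smul, ← pow_succ, hf]
  intro f hf
  exact key2 (m + 1) f (by ext j; simp) hf

/-- A group killed by `n` splits off a direct sum of copies of `ℤ / p ^ m`, where `p ^ m` is the
exact power of `p` in `n`, in such a way that the complement is killed by `n / p`. -/
theorem exists_equiv_prod_of_coprime {p m k : ℕ} (hp : p.Prime) (hk : p.Coprime k) (hk0 : k ≠ 0)
    {G : Type u} [AddCommGroup G] (hG : ∀ g : G, (p ^ (m + 1) * k) • g = 0) :
    ∃ (J : Type u) (K : AddSubgroup G), (∀ x ∈ K, (p ^ m * k) • x = 0) ∧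
      Nonempty (G ≃+ (J →₀ ZMod (p ^ (m + 1))) × K) := by
  have : Fact p.Prime := ⟨hp⟩
  -- With `n = p ^ (m + 1) * k`, this is `(n / p)G`, a vector space over `ℤ/p`. A basis of it counts
  -- the copies to split off.
  let V : AddSubgroup G := (nsmulAddMonoidHom (p ^ m * k) : G →+ G).range
  have hV : ∀ v : V, p • v = 0 := by
    rintro ⟨_, y, rfl⟩
    ext
    simp only [nsmulAddMonoidHom_apply, AddSubgroup.coe_nsmul, ZeroMemClass.coe_zero]
    rw [← mul_smul, ← hG y]; congr 1; ring
  obtain ⟨_⟩ : Nonempty (Module (ZMod p) V) := ⟨AddCommGroup.zmodModule hV⟩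
  let b := Module.Basis.ofVectorSpace (ZMod p) V
  let J := Module.Basis.ofVectorSpaceIndex (ZMod p) V
  have hy : ∀ j : J, ∃ y : G, (p ^ m * k) • y = (b j : G) := fun j => (b j).2
  choose y hy using hy
  let ι : (J →₀ ZMod (p ^ (m + 1))) →+ G := Finsupp.liftAddHom fun j =>
    ZMod.lift (p ^ (m + 1)) ⟨zmultiplesHom G (k • y j), by
      simp only [zmultiplesHom_apply, natCast_zsmul, ← mul_smul, hG]⟩
  have hι1 : ∀ j, p ^ m • ι (Finsupp.single j 1) = (b j : G) := by
    intro j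
    have : ((1 : ℤ) : ZMod (p ^ (m + 1))) = 1 := by simp
    rw [← hy, mul_smul]
    simp only [ι, Finsupp.liftAddHom_apply_single]
    rw [← this, ZMod.lift_coe]
    simp
  have hιinj : Function.Injective ι := by
    apply injective_of_linearIndependent_socle hp
    intro f hf j
    have h1 : (f.mapRange (Int.cast : ℤ → ZMod p) (by simp)) = 0 := by
      apply b.linearIndependent
      rw [map_zero, Finsupp.linearCombination_apply, Finsupp.sum_mapRange_index (by simp)]
      ext
      rw [ZeroMemClass.coe_zero, ← hf, Finsupp.sum, Finsupp.sum, AddSubgroup.val_finsetSum]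
      refine Finset.sum_congr rfl fun j _ => ?_
      rw [hι1, Int.cast_smul_eq_zsmul]; rfl
    have h2 := DFunLike.congr_fun h1 j
    simpa [ZMod.intCast_zmod_eq_zero_iff_dvd] using h2
  obtain ⟨r, hr⟩ := exists_leftInverse_of_injective_of_coprime (n := p ^ (m + 1) * k) rfl
    (Nat.Coprime.pow_left _ hk) (by simp [hp.ne_zero, hk0]) hG ι hιinj
  have hVι : ∀ v : V, ∃ h, ι h = (v : G) := by
    intro v
    suffices h : ∀ v : V, v ∈ (ι.range.comap V.subtype) from h v
    intro v
    rw [← b.linearCombination_repr v, Finsupp.linearCombination_apply]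
    refine AddSubgroup.sum_mem _ fun j _ => ?_
    obtain ⟨z, hz⟩ := ZMod.intCast_surjective (b.repr v j)
    simp only [← hz, Int.cast_smul_eq_zsmul]
    refine AddSubgroup.zsmul_mem _ ?_ _
    exact ⟨p ^ m • Finsupp.single j 1, by rw [map_nsmul, hι1]; rfl⟩
  refine ⟨J, r.ker, fun x hx => ?_, ⟨?_⟩⟩
  -- `(n / p)x` lies in `V`, hence in the image of `ι`, on which `r` is injective; but `r` kills it.
  · obtain ⟨h, hh⟩ := hVι ⟨_, x, rfl⟩
    have h1 : r (ι h) = 0 := by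
      rw [hh]; simp [map_nsmul, (AddMonoidHom.mem_ker).1 hx]
    rw [hr] at h1
    simpa [h1] using hh.symm
  · exact
      { toFun := fun g => (r g, ⟨g - ι (r g), by simp [AddMonoidHom.mem_ker, hr]⟩)
        invFun := fun x => ι x.1 + x.2
        left_inv := fun g => by simp
        right_inv := fun x => by
          have h2 : r (x.2 : G) = 0 := x.2.2
          ext <;> simp [hr, h2]
        map_add' := fun g g' => by
          ext
          · simp
          · simp; abel }

/-- A direct sum over a disjoint union is the product of the two direct sums. -/
noncomputable def DirectSum.sumAddEquivProd {J K : Type*} (β : J ⊕ K → Type*)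
    [∀ s, AddCommGroup (β s)] :
    (⨁ s, β s) ≃+ (⨁ j, β (Sum.inl j)) × (⨁ k, β (Sum.inr k)) := by
  classical
  let f : (⨁ s, β s) →+ (⨁ j, β (Sum.inl j)) × (⨁ k, β (Sum.inr k)) :=
    DirectSum.toAddMonoid fun s => match s with
      | Sum.inl j => (AddMonoidHom.inl _ _).comp (DirectSum.of (fun j => β (Sum.inl j)) j)
      | Sum.inr k => (AddMonoidHom.inr _ _).comp (DirectSum.of (fun k => β (Sum.inr k)) k)
  let g : (⨁ j, β (Sum.inl j)) →+ ⨁ s, β s :=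
    DirectSum.toAddMonoid fun j => DirectSum.of β (Sum.inl j)
  let h : (⨁ k, β (Sum.inr k)) →+ ⨁ s, β s :=
    DirectSum.toAddMonoid fun k => DirectSum.of β (Sum.inr k)
  have hg : f.comp g = AddMonoidHom.inl _ _ := by
    refine DirectSum.addHom_ext' fun j => AddMonoidHom.ext fun x => ?_
    simp [f, g]
  have hh : f.comp h = AddMonoidHom.inr _ _ := by
    refine DirectSum.addHom_ext' fun j => AddMonoidHom.ext fun x => ?_
    simp [f, h]
  refine AddMonoidHom.toAddEquiv f (g.coprod h) ?_ ?_
  · refine DirectSum.addHom_ext' fun s => AddMonoidHom.ext fun x => ?_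
    rcases s with j | k <;> simp [f, g, h]
  · rw [AddMonoidHom.comp_coprod, hg, hh, AddMonoidHom.coprod_inl_inr]

/-- Reindexing a direct sum of cyclic groups. -/
noncomputable def DirectSum.zmodCongr {J K : Type*} (e : J ≃ K) {q : J → ℕ} {q' : K → ℕ}
    (h : ∀ k, q (e.symm k) = q' k) : (⨁ j, ZMod (q j)) ≃+ ⨁ k, ZMod (q' k) :=
  (DirectSum.equivCongrLeft e).trans
    (DFinsupp.mapRange.addEquiv fun k => (ZMod.ringEquivCongr (h k)).toAddEquiv)

/-- A nested direct sum of copies of cyclic groups, written as a single direct sum. -/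
noncomputable def DirectSum.flattenZMod {P : Type} {I : P → Type} (index : ∀ p, I p → Type u)
    (q : ∀ p, I p → ℕ) :
    (⨁ s : Σ p : P, Σ i : I p, index p i, ZMod (q s.1 s.2.1)) ≃+
      ⨁ p : P, ⨁ i : I p, (index p i →₀ ZMod (q p i)) := by
  classical
  refine (DirectSum.sigmaCurryEquiv
    (δ := fun (p : P) (s : Σ i : I p, index p i) => ZMod (q p s.1))).trans ?_
  refine DFinsupp.mapRange.addEquiv fun p => ?_
  refine (DirectSum.sigmaCurryEquiv
    (δ := fun (i : I p) (_ : index p i) => ZMod (q p i))).trans ?_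
  exact DFinsupp.mapRange.addEquiv fun i => (finsuppAddEquivDFinsupp).symm

/-- A bounded abelian group is a direct sum of cyclic groups of prime power order. -/
theorem exists_addEquiv_directSum_zmod (n : ℕ) (hn : n ≠ 0) (G : Type u) [AddCommGroup G]
    (hG : ∀ g : G, n • g = 0) :
    ∃ (J : Type u) (p i : J → ℕ), (∀ j, (p j).Prime ∧ 1 ≤ i j ∧ p j ^ i j ∣ n) ∧
      Nonempty (G ≃+ ⨁ j, ZMod (p j ^ i j)) := by
  induction n using Nat.strong_induction_on generalizing G with
  | _ n ih =>
  rcases eq_or_ne n 1 with rfl | hn1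
  · have : Subsingleton G := ⟨fun a b => by rw [← one_smul ℕ a, hG, ← one_smul ℕ b, hG]⟩
    refine ⟨PEmpty, fun _ => 1, fun _ => 1, fun j => j.elim, ⟨?_⟩⟩
    exact
      { toFun := 0, invFun := 0, left_inv := fun _ => Subsingleton.elim _ _
        right_inv := fun _ => Subsingleton.elim _ _, map_add' := fun _ _ => Subsingleton.elim _ _ }
  obtain ⟨p, hp, hpn⟩ := Nat.exists_prime_and_dvd hn1
  obtain ⟨e, k, hk, rfl⟩ := Nat.exists_eq_pow_mul_and_not_dvd hn p hp.ne_one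
  obtain ⟨m, rfl⟩ : ∃ m, e = m + 1 := by
    refine Nat.exists_eq_succ_of_ne_zero ?_
    rintro rfl
    exact hk (by simpa using hpn)
  have hk0 : k ≠ 0 := by rintro rfl; simp at hk
  have hdvd : p ^ m * k ∣ p ^ (m + 1) * k := Nat.mul_dvd_mul_right (pow_dvd_pow _ m.le_succ) _
  obtain ⟨J, K, hK, ⟨f⟩⟩ :=
    exists_equiv_prod_of_coprime hp ((Nat.Prime.coprime_iff_not_dvd hp).2 hk) hk0 hG
  obtain ⟨J', p', i', h', ⟨f'⟩⟩ := ih (p ^ m * k)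
    (by
      refine Nat.mul_lt_mul_of_pos_right ?_ (Nat.pos_of_ne_zero hk0)
      exact Nat.pow_lt_pow_right hp.one_lt m.lt_succ_self)
    (by simp [hk0, hp.ne_zero]) K (fun x => Subtype.ext (by simpa using hK x x.2))
  refine ⟨J ⊕ J', Sum.elim (fun _ => p) p', Sum.elim (fun _ => m + 1) i', ?_, ⟨?_⟩⟩
  · rintro (j | j)
    · exact ⟨hp, by simp, Dvd.intro _ rfl⟩
    · exact ⟨(h' j).1, (h' j).2.1, (h' j).2.2.trans hdvd⟩
  · classical
    refine f.trans (AddEquiv.trans ?_ (DirectSum.sumAddEquivProd _).symm)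
    exact AddEquiv.prodCongr finsuppAddEquivDFinsupp f'

/-- The index set of the cyclic summands in an Ulm–Kaplansky decomposition. -/
abbrev UlmKaplanskyDecomposition.Summand {G : Type u} [AddCommGroup G]
    (D : UlmKaplanskyDecomposition G) : Type u :=
  Σ p : D.primes, Σ i : Finset.Icc 1 (D.top p), D.index p i

/-- An Ulm–Kaplansky decomposition as a single direct sum of cyclic groups. -/
noncomputable def UlmKaplanskyDecomposition.equivDirectSum {G : Type u} [AddCommGroup G]
    (D : UlmKaplanskyDecomposition G) :
    G ≃+ ⨁ s : D.Summand, ZMod ((s.1 : ℕ) ^ (s.2.1 : ℕ)) :=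
  D.equiv.trans (DirectSum.flattenZMod
    (fun (p : D.primes) (i : Finset.Icc 1 (D.top p)) => D.index p i)
    (fun p i => (p : ℕ) ^ (i : ℕ))).symm

theorem nonempty_ulmKaplanskyDecomposition {G : Type u} [AddCommGroup G] {n : ℕ} (hn : n ≠ 0)
    (hG : ∀ g : G, n • g = 0) : Nonempty (UlmKaplanskyDecomposition G) := by
  classical
  obtain ⟨J, p, i, h, ⟨f⟩⟩ := exists_addEquiv_directSum_zmod n hn G hG
  have hi : ∀ j, i j ≤ n := fun j => by
    have h1 := Nat.le_of_dvd (Nat.pos_of_ne_zero hn) (h j).2.2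
    exact (Nat.lt_pow_self (h j).1.one_lt).le.trans h1
  let P : Finset ℕ := n.primeFactors.filter fun q => ∃ j, p j = q
  have hP : ∀ j, p j ∈ P := fun j => by
    simp only [P, Finset.mem_filter, Nat.mem_primeFactors]
    exact ⟨⟨(h j).1, (dvd_pow_self _ (by have := (h j).2.1; omega)).trans (h j).2.2, hn⟩, j, rfl⟩
  let top : ℕ → ℕ := fun q => Nat.findGreatest (fun m => ∃ j, p j = q ∧ i j = m) n
  have htop : ∀ j, i j ≤ top (p j) := fun j => Nat.le_findGreatest (hi j) ⟨j, rfl, rfl⟩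
  have htop' : ∀ q ∈ P, ∃ j, p j = q ∧ i j = top q := by
    intro q hq
    obtain ⟨j, rfl⟩ := (Finset.mem_filter.1 hq).2
    exact Nat.findGreatest_spec (P := fun m => ∃ j', p j' = p j ∧ i j' = m) (hi j) ⟨j, rfl, rfl⟩
  let index : ℕ → ℕ → Type u := fun q m => {j : J // p j = q ∧ i j = m}
  let e : J ≃ Σ q : P, Σ m : Finset.Icc 1 (top q), index q m :=
    { toFun := fun j => ⟨⟨p j, hP j⟩, ⟨i j, Finset.mem_Icc.2 ⟨(h j).2.1, htop j⟩⟩, ⟨j, rfl, rfl⟩⟩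
      invFun := fun s => s.2.2.1
      left_inv := fun j => rfl
      right_inv := by
        rintro ⟨⟨q, hq⟩, ⟨m, hm⟩, ⟨j, hj1, hj2⟩⟩
        obtain rfl : p j = q := hj1
        obtain rfl : i j = m := hj2
        rfl }
  refine ⟨⟨P, fun q hq => ?_, top, fun q hq => ?_, index, fun q hq => ?_, ?_⟩⟩
  · exact Nat.prime_of_mem_primeFactors (Finset.mem_filter.1 hq).1
  · obtain ⟨j, rfl, hj⟩ := htop' q hq
    rw [← hj]; exact (h j).2.1
  · obtain ⟨j, hj⟩ := htop' q hq
    exact ⟨⟨j, hj⟩⟩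
  · refine f.trans ((DirectSum.zmodCongr e ?_).trans (DirectSum.flattenZMod
      (fun (q : P) (m : Finset.Icc 1 (top q)) => index q m) (fun q m => (q : ℕ) ^ (m : ℕ))))
    rintro ⟨⟨q, hq⟩, ⟨m, hm⟩, ⟨j, hj1, hj2⟩⟩
    simp [e, hj1, hj2]

/-! ### Permanence of minimal almost periodicity -/

/-- A finite kernel is closed, so the quotient topology is Hausdorff; characters pull back to `A`.
-/
theorem AdmitsMinAPGroupTopology.of_surjective {A : Type*} {G : Type u} [AddCommGroup A]
    [AddCommGroup G] (hA : AdmitsMinAPGroupTopology A) (f : A →+ G) (hf : Function.Surjective f)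
    (hker : (f.ker : Set A).Finite) : AdmitsMinAPGroupTopology G := by
  obtain ⟨τ, h1, h2, h3⟩ := hA
  have : IsClosed (f.ker : Set A) := hker.isClosed
  let e : A ⧸ f.ker ≃+ G := QuotientAddGroup.quotientKerEquivOfSurjective f hf
  let τG : TopologicalSpace G := TopologicalSpace.induced e.symm inferInstance
  refine ⟨τG, topologicalAddGroup_induced e.symm,
    T2Space.of_injective_continuous e.symm.injective continuous_induced_dom, fun χ hχ => ?_⟩
  have he : Continuous e := continuous_induced_rng.2 (by
    convert continuous_id (X := A ⧸ f.ker)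
    ext x; simp)
  have h4 := h3 (χ.comp (e.toAddMonoidHom.comp (QuotientAddGroup.mk' f.ker)))
    (hχ.comp (he.comp continuous_quotient_mk'))
  ext g
  obtain ⟨a, rfl⟩ := hf g
  exact DFunLike.congr_fun h4 a

theorem AdmitsMinAPGroupTopology.of_addEquiv {A : Type*} {G : Type u} [AddCommGroup A]
    [AddCommGroup G] (hA : AdmitsMinAPGroupTopology A) (e : A ≃+ G) :
    AdmitsMinAPGroupTopology G := by
  refine hA.of_surjective e.toAddMonoidHom e.surjective ?_
  have : (e.toAddMonoidHom.ker : Set A) = {0} := by ext; simp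
  rw [this]
  exact Set.finite_singleton 0

/-- A direct sum of minimally almost periodic groups is minimally almost periodic in the topology
induced by the product. -/
theorem AdmitsMinAPGroupTopology.directSum {K : Type u} {V : K → Type*} [∀ k, AddCommGroup (V k)]
    (hV : ∀ k, AdmitsMinAPGroupTopology (V k)) : AdmitsMinAPGroupTopology (⨁ k, V k) := by
  classical
  choose τ h1 h2 h3 using hV
  let φ : (⨁ k, V k) →+ ∀ k, V k := DFinsupp.coeFnAddMonoidHom
  let _ : TopologicalSpace (⨁ k, V k) := TopologicalSpace.induced φ inferInstance
  refine ⟨_, topologicalAddGroup_induced φ,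
    T2Space.of_injective_continuous (f := φ) DFunLike.coe_injective continuous_induced_dom,
    fun χ hχ => ?_⟩
  refine DirectSum.addHom_ext' fun k => ?_
  refine h3 k _ (hχ.comp (continuous_induced_rng.2 ?_))
  convert continuous_single (A := V) k using 1
  ext x j
  change DirectSum.of V k x j = Pi.single k x j
  rcases eq_or_ne j k with rfl | h
  · simp
  · simp [DirectSum.of_eq_of_ne _ _ _ h, h]

/-! ### Step functions with the topology of convergence in measure -/

/-- The value at `t` of the step function on `[0, ∞)` which `f` represents as a combination of
indicator functions of the intervals `[0, q)`. -/
noncomputable def stepValue {M : Type*} [AddCommGroup M] (t : ℝ) :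
    ({q : ℚ // 0 < q} →₀ M) →+ M :=
  Finsupp.liftAddHom fun q => if t < (q : ℚ) then AddMonoidHom.id M else 0

theorem stepValue_apply {M : Type*} [AddCommGroup M] (t : ℝ) (f : {q : ℚ // 0 < q} →₀ M) :
    stepValue t f = ∑ q ∈ f.support, if t < ((q : ℚ) : ℝ) then f q else 0 := by
  rw [stepValue, Finsupp.liftAddHom_apply, Finsupp.sum]
  refine Finset.sum_congr rfl fun q _ => ?_
  split_ifs <;> simp

theorem stepValue_single {M : Type*} [AddCommGroup M] (t : ℝ) (q : {q : ℚ // 0 < q}) (a : M) :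
    stepValue t (Finsupp.single q a) = if t < ((q : ℚ) : ℝ) then a else 0 := by
  rw [stepValue, Finsupp.liftAddHom_apply_single]
  split_ifs <;> simp

/-- The support of the step function represented by `f`. -/
def stepSupport {M : Type*} [AddCommGroup M] (f : {q : ℚ // 0 < q} →₀ M) : Set ℝ :=
  {t | 0 ≤ t ∧ stepValue t f ≠ 0}

open MeasureTheory in
theorem volume_stepSupport_ne_top {M : Type*} [AddCommGroup M] (f : {q : ℚ // 0 < q} →₀ M) :
    volume (stepSupport f) ≠ ⊤ := by
  refine ne_top_of_le_ne_top (b := volume (Set.Icc (0 : ℝ) (∑ q ∈ f.support, ((q : ℚ) : ℝ))))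
    (by simp) (measure_mono ?_)
  rintro t ⟨ht0, ht⟩
  refine ⟨ht0, ?_⟩
  by_contra! hlt
  apply ht
  rw [stepValue_apply]
  refine Finset.sum_eq_zero fun q hq => if_neg ?_
  have := Finset.single_le_sum (f := fun q : {q : ℚ // 0 < q} => ((q : ℚ) : ℝ))
    (fun q _ => by exact_mod_cast q.2.le) hq
  linarith

-- Just below the largest `q` in the support, only the term at `q` contributes.
open MeasureTheory in
theorem volume_stepSupport_pos {M : Type*} [AddCommGroup M] {f : {q : ℚ // 0 < q} →₀ M}
    (hf : f ≠ 0) : 0 < volume (stepSupport f) := by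
  classical
  have hne : f.support.Nonempty := by simpa [Finset.nonempty_iff_ne_empty] using hf
  set q := f.support.max' hne with hq
  have hqs : q ∈ f.support := Finset.max'_mem _ _
  -- Including `0` keeps the interval `[max S, q)` inside `[0, ∞)`, even when `q` is the only jump.
  let S : Finset ℝ := insert 0 ((f.support.erase q).image fun q : {q : ℚ // 0 < q} => ((q : ℚ) : ℝ))
  have hS : S.Nonempty := ⟨0, by simp [S]⟩
  have hr0 : (0 : ℝ) ≤ S.max' hS := Finset.le_max' _ _ (by simp [S])
  have hrq : S.max' hS < ((q : ℚ) : ℝ) := by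
    rw [Finset.max'_lt_iff]
    intro y hy
    rcases Finset.mem_insert.1 hy with rfl | hy
    · exact_mod_cast q.2
    · obtain ⟨q', hq', rfl⟩ := Finset.mem_image.1 hy
      have h1 : q' ≤ q := Finset.le_max' _ _ (Finset.mem_of_mem_erase hq')
      have h2 : q' < q := lt_of_le_of_ne h1 (Finset.ne_of_mem_erase hq')
      exact_mod_cast h2
  refine lt_of_lt_of_le ?_ (measure_mono (s := Set.Ico (S.max' hS) ((q : ℚ) : ℝ)) ?_)
  · simpa using hrq
  · rintro t ⟨ht1, ht2⟩
    refine ⟨hr0.trans ht1, ?_⟩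
    rw [stepValue_apply, Finset.sum_eq_single q]
    · rw [if_pos ht2]; exact Finsupp.mem_support_iff.1 hqs
    · intro q' hq' hne'
      refine if_neg (not_lt.2 (le_trans (Finset.le_max' S _ ?_) ht1))
      exact Finset.mem_insert_of_mem
        (Finset.mem_image_of_mem _ (Finset.mem_erase.2 ⟨hne', hq'⟩))
    · exact fun h => absurd hqs h

open MeasureTheory in
/-- The measure of the support, as a norm on the group of step functions. -/
noncomputable def stepNorm (M : Type*) [AddCommGroup M] : AddGroupNorm ({q : ℚ // 0 < q} →₀ M) where
  toFun f := (volume (stepSupport f)).toReal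
  map_zero' := by simp [stepSupport]
  neg' f := by simp [stepSupport]
  add_le' f g := by
    rw [← ENNReal.toReal_add (volume_stepSupport_ne_top f) (volume_stepSupport_ne_top g)]
    refine ENNReal.toReal_mono ?_ ((measure_mono ?_).trans (measure_union_le _ _))
    · simp [volume_stepSupport_ne_top]
    · rintro t ⟨h0, ht⟩
      rw [map_add] at ht
      by_cases h : stepValue t f = 0
      · exact Or.inr ⟨h0, fun h' => ht (by rw [h, h', add_zero])⟩
      · exact Or.inl ⟨h0, h⟩
  eq_zero_of_map_eq_zero' f h := by
    by_contra hf
    exact (ENNReal.toReal_pos (volume_stepSupport_pos hf).ne' (volume_stepSupport_ne_top f)).ne' h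

open MeasureTheory in
theorem stepNorm_le_of_subset {M : Type*} [AddCommGroup M] {f : {q : ℚ // 0 < q} →₀ M} {a b : ℝ}
    (hab : a ≤ b) (h : stepSupport f ⊆ Set.Ico a b) : stepNorm M f ≤ b - a := by
  refine ENNReal.toReal_le_of_le_ofReal (by linarith) ?_
  simpa using measure_mono (μ := volume) h

theorem stepNorm_single_le {M : Type*} [AddCommGroup M] (q : {q : ℚ // 0 < q}) (a : M) :
    stepNorm M (Finsupp.single q a) ≤ ((q : ℚ) : ℝ) := by
  have h0 : (0 : ℝ) ≤ ((q : ℚ) : ℝ) := by exact_mod_cast q.2.le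
  refine (stepNorm_le_of_subset h0 ?_).trans (by simp)
  rintro t ⟨ht0, ht⟩
  rw [stepValue_single] at ht
  exact ⟨ht0, by by_contra h; simp [h] at ht⟩

theorem stepNorm_single_sub_single_le {M : Type*} [AddCommGroup M] {q q' : {q : ℚ // 0 < q}}
    (h : q ≤ q') (a : M) :
    stepNorm M (Finsupp.single q' a - Finsupp.single q a) ≤ ((q' : ℚ) : ℝ) - ((q : ℚ) : ℝ) := by
  have h0 : ((q : ℚ) : ℝ) ≤ ((q' : ℚ) : ℝ) := by exact_mod_cast h
  refine stepNorm_le_of_subset h0 ?_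
  rintro t ⟨ht0, ht⟩
  rw [map_sub, stepValue_single, stepValue_single] at ht
  constructor
  · by_contra h'
    rw [if_pos (by linarith), if_pos (by linarith), sub_self] at ht
    exact ht rfl
  · by_contra h'
    rw [if_neg (by linarith), if_neg (by linarith), sub_self] at ht
    exact ht rfl

/-- Elements of small norm generate the group of step functions. -/
theorem eq_zero_of_stepNorm_lt {M B : Type*} [AddCommGroup M] [AddCommGroup B]
    (χ : ({q : ℚ // 0 < q} →₀ M) →+ B) {ε : ℝ} (hε : 0 < ε)
    (h : ∀ f, stepNorm M f < ε → χ f = 0) : χ = 0 := by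
  -- A rational `δ` makes `q - δ` again an index. The indicators of `[0, q)` and `[0, q - δ)` differ
  -- on length `δ < ε`, so induction proceeds in steps of `δ`.
  obtain ⟨δ, hδ0, hδ⟩ := exists_rat_btwn hε
  have hδ0' : 0 < δ := by exact_mod_cast hδ0
  have key : ∀ k : ℕ, ∀ q : {q : ℚ // 0 < q}, (q : ℚ) ≤ (k + 1) * δ → ∀ a,
      χ (Finsupp.single q a) = 0 := by
    intro k
    induction k with
    | zero =>
      intro q hq a
      refine h _ ((stepNorm_single_le q a).trans_lt (lt_of_le_of_lt ?_ hδ))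
      exact_mod_cast (by simpa using hq : (q : ℚ) ≤ δ)
    | succ k ih =>
      intro q hq a
      rcases le_or_gt (q : ℚ) ((k + 1) * δ) with hle | hlt
      · exact ih q hle a
      have hk : δ ≤ (k + 1) * δ := by
        have : (0 : ℚ) ≤ k * δ := by positivity
        linarith
      let q' : {q : ℚ // 0 < q} := ⟨q - δ, by linarith⟩
      have h1 : χ (Finsupp.single q' a) = 0 := by
        refine ih q' ?_ a
        push_cast at hq
        change (q : ℚ) - δ ≤ _
        linarith
      have h2 : χ (Finsupp.single q a - Finsupp.single q' a) = 0 := by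
        refine h _ ((stepNorm_single_sub_single_le ?_ a).trans_lt (lt_of_eq_of_lt ?_ hδ))
        · change (q : ℚ) - δ ≤ q
          linarith
        · simp [q']
      rwa [map_sub, h1, sub_zero] at h2
  ext q a
  obtain ⟨k, hk⟩ := exists_nat_ge ((q : ℚ) / δ)
  refine key k q ?_ a
  rw [div_le_iff₀ hδ0'] at hk
  linarith

/-- A bounded group of step functions is minimally almost periodic in the topology of convergence
in measure. -/
theorem admitsMinAPGroupTopology_step {M : Type*} [AddCommGroup M] {n : ℕ} (hn : 0 < n)
    (hM : ∀ a : M, n • a = 0) : AdmitsMinAPGroupTopology ({q : ℚ // 0 < q} →₀ M) := by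
  let _ : NormedAddCommGroup ({q : ℚ // 0 < q} →₀ M) := (stepNorm M).toNormedAddCommGroup
  refine ⟨inferInstance, inferInstance, inferInstance, fun χ hχ => ?_⟩
  -- All values of `χ` are `n`-torsion. Removing the finitely many nonzero ones leaves a
  -- neighbourhood of `0`, so `χ` vanishes on a ball.
  have hfin : ({u : UnitAddCircle | n • u = 0} \ {0}).Finite :=
    (AddCircle.finite_torsion 1 hn).subset Set.sdiff_subset
  have hnhds : χ ⁻¹' ({u : UnitAddCircle | n • u = 0} \ {0})ᶜ ∈ nhds 0 :=
    (hfin.isClosed.isOpen_compl.preimage hχ).mem_nhds (by simp)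
  obtain ⟨ε, hε, hball⟩ := Metric.mem_nhds_iff.1 hnhds
  refine eq_zero_of_stepNorm_lt χ hε fun f hf => ?_
  have h1 : f ∈ Metric.ball (0 : {q : ℚ // 0 < q} →₀ M) ε := by
    rw [mem_ball_zero_iff]; exact hf
  by_contra h0
  refine hball h1 ⟨?_, h0⟩
  have : n • f = 0 := by ext q; simp [hM]
  simp [← map_nsmul, this]

/-! ### Infinite leading invariants give a minimally almost periodic topology -/

theorem nonempty_equiv_prod_of_infinite (X : Type u) (Q : Type) [Countable Q] [Infinite Q]
    (hX : IsEmpty X ∨ Infinite X) : Nonempty (X × Q ≃ X) := by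
  rcases hX with h | h
  · exact ⟨Equiv.equivOfIsEmpty _ _⟩
  · rw [← Cardinal.eq, Cardinal.mk_prod, Cardinal.mk_eq_aleph0 Q]
    simp

/-- Each nonempty fibre of `q` is infinite and so absorbs a countable factor; the bijections are
glued over the fibres. -/
theorem exists_equiv_prod_preserving {J : Type u} (Q : Type) [Countable Q] [Infinite Q]
    (q : J → ℕ) (hq : ∀ j, {j' | q j' = q j}.Infinite) :
    ∃ e : (Σ _ : J, Q) ≃ J, ∀ s, q (e s) = q s.1 := by
  have hF : ∀ v, Nonempty ({j // q j = v} × Q ≃ {j // q j = v}) := by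
    intro v
    apply nonempty_equiv_prod_of_infinite
    rcases isEmpty_or_nonempty {j // q j = v} with h | ⟨⟨j, rfl⟩⟩
    · exact Or.inl h
    · exact Or.inr (hq j).to_subtype
  let ε := fun v => (hF v).some
  refine ⟨(Equiv.sigmaEquivProd J Q).trans
    (((Equiv.sigmaFiberEquiv q).symm.prodCongr (Equiv.refl Q)).trans
      ((Equiv.sigmaProdDistrib _ _).trans
        ((Equiv.sigmaCongrRight ε).trans (Equiv.sigmaFiberEquiv q)))), ?_⟩
  rintro ⟨j, x⟩
  exact (ε (q j) (⟨j, rfl⟩, x)).2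

/-- A direct sum of cyclic groups, in which each order that occurs occurs infinitely often, admits
a minimally almost periodic topology. -/
theorem admitsMinAPGroupTopology_directSum_zmod {J : Type u} (q : J → ℕ) (hq0 : ∀ j, 0 < q j)
    (hq : ∀ j, {j' | q j' = q j}.Infinite) :
    AdmitsMinAPGroupTopology (⨁ j, ZMod (q j)) := by
  classical
  have : Infinite {q : ℚ // 0 < q} := (Set.Ioi_infinite (0 : ℚ)).to_subtype
  obtain ⟨e, he⟩ := exists_equiv_prod_preserving {q : ℚ // 0 < q} q hq
  have h1 : AdmitsMinAPGroupTopology (⨁ j : J, ({q : ℚ // 0 < q} →₀ ZMod (q j))) :=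
    AdmitsMinAPGroupTopology.directSum fun j =>
      admitsMinAPGroupTopology_step (hq0 j) (fun a => by simp)
  refine h1.of_addEquiv (AddEquiv.trans (AddEquiv.trans
    (DFinsupp.mapRange.addEquiv fun j => finsuppAddEquivDFinsupp)
    (DirectSum.sigmaCurryEquiv (δ := fun (j : J) (_ : {q : ℚ // 0 < q}) => ZMod (q j))).symm)
    (DirectSum.zmodCongr e fun j => ?_))
  rw [← he, Equiv.apply_symm_apply]

theorem ZMod.castHom_injective_of_eq {n N : ℕ} (h : n ∣ N) (e : N = n) :
    Function.Injective (ZMod.castHom h (ZMod n)) := by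
  subst e
  rw [ZMod.castHom_self]
  exact fun _ _ h => h

/-- Coordinatewise reduction has a finite kernel, since only finitely many summands change. This
permits enlarging the finite blocks of a decomposition. -/
theorem admitsMinAPGroupTopology_directSum_zmod_of_dvd {J : Type u} {n N : J → ℕ}
    (hN : AdmitsMinAPGroupTopology (⨁ j, ZMod (N j))) (hN0 : ∀ j, N j ≠ 0) (h : ∀ j, n j ∣ N j)
    (hfin : {j | N j ≠ n j}.Finite) : AdmitsMinAPGroupTopology (⨁ j, ZMod (n j)) := by
  let f : (⨁ j, ZMod (N j)) →+ ⨁ j, ZMod (n j) :=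
    DFinsupp.mapRange.addMonoidHom fun j => (ZMod.castHom (h j) (ZMod (n j))).toAddMonoidHom
  have hf : ∀ x j, f x j = ZMod.castHom (h j) (ZMod (n j)) (x j) := fun x j => rfl
  refine hN.of_surjective f ?_ ?_
  · exact (DFinsupp.mapRange_surjective _ fun j => map_zero _).2
      fun j => ZMod.castHom_surjective (h j)
  · have : Finite {j | N j ≠ n j} := hfin
    have : ∀ j, NeZero (N j) := fun j => ⟨hN0 j⟩
    refine Set.Finite.of_injOn (f := fun x (j : {j | N j ≠ n j}) => x j)
      (t := (Set.univ : Set (∀ j : {j | N j ≠ n j}, ZMod (N j))))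
      (fun _ _ => Set.mem_univ _) ?_ Set.finite_univ
    intro x hx y hy hxy
    refine DFinsupp.ext fun j => ?_
    by_cases hj : N j = n j
    · apply ZMod.castHom_injective_of_eq (h j) hj
      rw [← hf, ← hf, (AddMonoidHom.mem_ker).1 hx, (AddMonoidHom.mem_ker).1 hy]
    · exact congrFun hxy ⟨j, hj⟩

theorem UlmKaplanskyDecomposition.admitsMinAPGroupTopology {G : Type u} [AddCommGroup G]
    (D : UlmKaplanskyDecomposition G)
    (h : ∀ p ∈ D.primes, Cardinal.aleph0 ≤ D.leadingInvariant p) :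
    AdmitsMinAPGroupTopology G := by
  classical
  have hinf : ∀ p ∈ D.primes, Infinite (D.index p (D.top p)) := fun p hp =>
    Cardinal.infinite_iff.2 (h p hp)
  -- Summands in finite blocks are raised to order `p ^ m_p`, which already occurs infinitely often.
  let N : D.Summand → ℕ := fun s =>
    if Infinite (D.index s.1 s.2.1) then (s.1 : ℕ) ^ (s.2.1 : ℕ) else (s.1 : ℕ) ^ D.top s.1
  have hp0 : ∀ s : D.Summand, 0 < (s.1 : ℕ) := fun s => (D.prime_of_mem _ s.1.2).pos
  have hN0 : ∀ s, 0 < N s := fun s => by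
    simp only [N]; split_ifs <;> exact pow_pos (hp0 s) _
  refine AdmitsMinAPGroupTopology.of_addEquiv (admitsMinAPGroupTopology_directSum_zmod_of_dvd
    (N := N) (admitsMinAPGroupTopology_directSum_zmod N hN0 ?_) (fun s => (hN0 s).ne') ?_ ?_)
    D.equivDirectSum.symm
  · rintro ⟨p, i, x⟩
    by_cases hi : Infinite (D.index p i)
    · refine (Set.infinite_range_of_injective
        (f := fun y : D.index p i => (⟨p, i, y⟩ : D.Summand)) ?_).mono ?_
      · intro y z hyz
        simpa using hyz
      · rintro _ ⟨y, rfl⟩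
        simp [N, hi]
    · have := hinf p p.2
      refine (Set.infinite_range_of_injective
        (f := fun y : D.index p (D.top p) => (⟨p, ⟨D.top p,
          Finset.mem_Icc.2 ⟨D.one_le_top p p.2, le_rfl⟩⟩, y⟩ : D.Summand)) ?_).mono ?_
      · intro y z hyz
        simpa using hyz
      · rintro _ ⟨y, rfl⟩
        simp [N, hi, this]
  · intro s
    simp only [N]
    split_ifs
    · exact dvd_rfl
    · exact pow_dvd_pow _ (Finset.mem_Icc.1 s.2.1.2).2
  · refine Set.Finite.subset (s := ⋃ p : D.primes, ⋃ i : Finset.Icc 1 (D.top p),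
      {s | ∃ x, s = ⟨p, i, x⟩ ∧ Finite (D.index p i)}) ?_ ?_
    · refine Set.finite_iUnion fun p => Set.finite_iUnion fun i => ?_
      by_cases hi : Finite (D.index p i)
      · refine (Set.finite_range fun x : D.index p i => (⟨p, i, x⟩ : D.Summand)).subset ?_
        rintro _ ⟨x, rfl, -⟩
        exact ⟨x, rfl⟩
      · simp [hi]
    · rintro ⟨p, i, x⟩ hs
      simp only [Set.mem_iUnion]
      refine ⟨p, i, x, rfl, ?_⟩
      by_contra hi
      rw [not_finite_iff_infinite] at hi
      exact hs (if_pos hi)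

/-! ### Finite multiples of the group as the obstruction -/

/-- Every multiple `n G` of `G` is either trivial or infinite. -/
def MultiplesTrivialOrInfinite (G : Type u) [AddCommGroup G] : Prop :=
  ∀ n : ℤ, (∀ x : G, n • x = 0) ∨ (Set.range fun x : G => n • x).Infinite

/-- Characters into `ℚ/ℤ` separate points, and `ℚ/ℤ` embeds in `ℝ/ℤ`. -/
theorem exists_addMonoidHom_unitAddCircle_apply_ne_zero {R : Type*} [AddCommGroup R] {y : R}
    (hy : y ≠ 0) : ∃ c : R →+ UnitAddCircle, c y ≠ 0 := by
  obtain ⟨c, hc⟩ := CharacterModule.exists_character_apply_ne_zero_of_ne_zero hy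
  let φ : AddCircle (1 : ℚ) →+ UnitAddCircle :=
    QuotientAddGroup.map _ _ (Rat.castHom ℝ).toAddMonoidHom (by
      rw [AddSubgroup.zmultiples_le]
      exact ⟨1, by simp⟩)
  have hφ : ∀ u, φ u = 0 → u = 0 := by
    intro u
    induction u using QuotientAddGroup.induction_on with
    | H u =>
      intro hu
      have hu' : (((u : ℝ)) : UnitAddCircle) = 0 := hu
      obtain ⟨k, hk⟩ := (AddCircle.coe_eq_zero_iff (1 : ℝ)).1 hu'
      refine (AddCircle.coe_eq_zero_iff (1 : ℚ)).2 ⟨k, ?_⟩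
      simp only [zsmul_eq_mul, mul_one] at hk ⊢
      exact_mod_cast hk
  exact ⟨φ.comp c, fun h => hc (hφ _ h)⟩

/-- If `nG` is finite, the `n`-torsion is closed of finite index, hence open, so every character of
`nG` composed with `x ↦ n • x` is continuous. -/
theorem AdmitsMinAPGroupTopology.multiplesTrivialOrInfinite {G : Type u} [AddCommGroup G]
    (h : AdmitsMinAPGroupTopology G) : MultiplesTrivialOrInfinite G := by
  obtain ⟨τ, h1, h2, h3⟩ := h
  intro n
  by_contra! hn
  obtain ⟨⟨x, hx⟩, hfin⟩ := hn
  let f : G →+ G := zsmulAddGroupHom n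
  have hfc : Continuous f := continuous_zsmul n
  have : Finite f.range := hfin
  have hclosed : IsClosed (f.ker : Set G) := isClosed_singleton.preimage hfc
  have hopen : IsOpen (f.ker : Set G) :=
    AddSubgroup.isOpen_of_isClosed_of_finiteIndex f.ker hclosed
  obtain ⟨c, hc⟩ := exists_addMonoidHom_unitAddCircle_apply_ne_zero
    (y := f.rangeRestrict x) (fun h => hx (congrArg Subtype.val h))
  refine hc ?_
  have hcont : Continuous (c.comp f.rangeRestrict) := by
    refine continuous_of_continuousAt_zero _ ?_
    refine (continuousAt_const (y := (0 : UnitAddCircle))).congr ?_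
    filter_upwards [hopen.mem_nhds (zero_mem f.ker)] with y hy
    have : f.rangeRestrict y = 0 := Subtype.ext hy
    simp [this]
  exact DFunLike.congr_fun (h3 _ hcont) x

theorem isElementaryAlgebraic_iff {G : Type u} [AddCommGroup G] {A : Set G} :
    IsElementaryAlgebraic A ↔ ∃ (a : G) (n : ℤ), A = {x | a + n • x = 0} := by
  constructor
  · rintro ⟨w, rfl⟩
    refine ⟨(w.map Prod.fst).sum, (w.map Prod.snd).sum, ?_⟩
    ext x
    have : (w.map fun t => t.1 + t.2 • x).sum =
        (w.map Prod.fst).sum + (w.map Prod.snd).sum • x := by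
      induction w with
      | nil => simp
      | cons t w ih => simp only [List.map_cons, List.sum_cons, ih, add_smul]; abel
    rw [Set.mem_ofPred_eq, Set.mem_ofPred_eq, this]
  · rintro ⟨a, n, rfl⟩
    exact ⟨[(a, n)], by simp⟩

theorem isClosed_zariskiTopology_setOf {G : Type u} [AddCommGroup G] (a : G) (n : ℤ) :
    @IsClosed G (zariskiTopology G) {x | a + n • x = 0} := by
  let _ := zariskiTopology G
  refine ⟨TopologicalSpace.isOpen_generateFrom_of_mem ?_⟩
  rw [Set.mem_ofPred_eq, compl_compl, isElementaryAlgebraic_iff]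
  exact ⟨a, n, rfl⟩

/-- If `nG` is finite, the complement of the `n`-torsion is a finite union of closed fibres of `x ↦
n • x`. -/
theorem IsZariskiConnected.multiplesTrivialOrInfinite {G : Type u} [AddCommGroup G]
    (h : IsZariskiConnected G) : MultiplesTrivialOrInfinite G := by
  intro n
  let _ := zariskiTopology G
  have : ConnectedSpace G := h
  by_contra! hn
  obtain ⟨⟨x, hx⟩, hfin⟩ := hn
  have hfin' : (Set.range fun x : G => n • x).Finite := hfin
  have hclosed : IsClosed {x : G | n • x = 0} := by
    simpa using isClosed_zariskiTopology_setOf (0 : G) n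
  have hcompl : {x : G | n • x = 0}ᶜ =
      ⋃ y ∈ (Set.range fun x : G => n • x) \ {0}, {x | -y + n • x = 0} := by
    ext z
    simp only [Set.mem_compl_iff, Set.mem_ofPred_eq, Set.mem_iUnion, exists_prop]
    constructor
    · intro hz
      exact ⟨n • z, ⟨⟨z, rfl⟩, hz⟩, by simp⟩
    · rintro ⟨y, ⟨-, hy⟩, hyz⟩ hz
      rw [hz, add_zero, neg_eq_zero] at hyz
      exact hy hyz
  have hopen : IsOpen {x : G | n • x = 0} := by
    rw [← isClosed_compl_iff, hcompl]
    exact (hfin'.subset Set.sdiff_subset).isClosed_biUnion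
      fun y _ => isClosed_zariskiTopology_setOf _ _
  have huniv := IsClopen.eq_univ ⟨hclosed, hopen⟩ ⟨(0 : G), by simp⟩
  exact hx (huniv ▸ Set.mem_univ x : x ∈ {x : G | n • x = 0})

open scoped Pointwise in
/-- A proper nonempty elementary algebraic set is a coset of a subgroup of infinite index. -/
theorem MultiplesTrivialOrInfinite.exists_subset_coset {G : Type u} [AddCommGroup G]
    (h : MultiplesTrivialOrInfinite G) {A : Set G} (hA : IsElementaryAlgebraic A)
    (hne : A.Nonempty) (hA' : A ≠ Set.univ) :
    ∃ (g : G) (H : AddSubgroup G), ¬ H.FiniteIndex ∧ A ⊆ g +ᵥ (H : Set G) := by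
  obtain ⟨a, n, rfl⟩ := isElementaryAlgebraic_iff.1 hA
  obtain ⟨g, hg⟩ := hne
  rw [Set.mem_ofPred_eq] at hg
  let f : G →+ G := zsmulAddGroupHom n
  refine ⟨g, f.ker, fun hfi => ?_, fun x hx => ?_⟩
  · rcases h n with h0 | hinf
    · apply hA'
      rw [h0, add_zero] at hg
      simp [h0, hg]
    · apply hinf
      have : Finite (G ⧸ f.ker) := AddSubgroup.finite_quotient_of_finiteIndex
      have : Finite f.range := Finite.of_equiv _ (QuotientAddGroup.quotientKerEquivRange f).toEquiv
      exact (show (f.range : Set G).Finite from this).subset (by rintro _ ⟨x, rfl⟩; exact ⟨x, rfl⟩)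
  · rw [Set.mem_vadd_set_iff_neg_vadd_mem]
    rw [Set.mem_ofPred_eq] at hx
    change n • (-g + x) = 0
    rw [smul_add, smul_neg]
    rw [← sub_eq_zero.2 (hx.trans hg.symm)]
    abel

/-- By B. H. Neumann's lemma, finitely many cosets of subgroups of infinite index cannot cover `G`.
-/
theorem MultiplesTrivialOrInfinite.sInter_nonempty {G : Type u} [AddCommGroup G]
    (h : MultiplesTrivialOrInfinite G) {F : Set (Set G)} (hF : F.Finite)
    (hE : ∀ U ∈ F, IsElementaryAlgebraic Uᶜ) (hne : ∀ U ∈ F, U.Nonempty) :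
    (⋂₀ F).Nonempty := by
  classical
  by_contra hempty
  let s : Finset (Set G) := hF.toFinset.filter fun U => Uᶜ.Nonempty
  have hs : ∀ U, U ∈ s ↔ U ∈ F ∧ Uᶜ.Nonempty := by simp [s]
  have hcoset : ∀ U : Set G, ∃ (g : G) (H : AddSubgroup G), U ∈ s →
      ¬ H.FiniteIndex ∧ Uᶜ ⊆ {x | -g + x ∈ H} := by
    intro U
    by_cases hU : U ∈ s
    · obtain ⟨hUF, hUne⟩ := (hs U).1 hU
      obtain ⟨g, H, h1, h2⟩ := h.exists_subset_coset (hE U hUF) hUne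
        (fun hu => (hne U hUF).ne_empty (by simpa using hu))
      exact ⟨g, H, fun _ => ⟨h1, fun x hx => by
        simpa [Set.mem_vadd_set_iff_neg_vadd_mem] using h2 hx⟩⟩
    · exact ⟨0, ⊤, fun h => absurd h hU⟩
  choose g H hgH using hcoset
  obtain ⟨U, hU, hfi⟩ := AddSubgroup.exists_finiteIndex_of_leftCoset_cover (s := s) (g := g)
    (H := H) (by
      rw [Set.eq_univ_iff_forall]
      intro x
      have hx : x ∉ ⋂₀ F := fun hx => hempty ⟨x, hx⟩
      simp only [Set.mem_sInter, not_forall] at hx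
      obtain ⟨U, hUF, hxU⟩ := hx
      have hU : U ∈ s := (hs U).2 ⟨hUF, x, hxU⟩
      refine Set.mem_biUnion hU ?_
      rw [Set.mem_vadd_set_iff_neg_vadd_mem]
      exact (hgH U hU).2 hxU)
  exact (hgH U hU).1 hfi

/-- Any two nonempty open sets contain nonempty finite intersections of subbasic sets, and these
meet. Thus `G` is even irreducible. -/
theorem MultiplesTrivialOrInfinite.isZariskiConnected {G : Type u} [AddCommGroup G]
    (h : MultiplesTrivialOrInfinite G) : IsZariskiConnected G := by
  let _ := zariskiTopology G
  have hbasis := TopologicalSpace.isTopologicalBasis_of_subbasis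
    (rfl : zariskiTopology G = TopologicalSpace.generateFrom _)
  have hirr : PreirreducibleSpace G := by
    refine ⟨fun U V hU hV => ?_⟩
    rintro ⟨x, -, hxU⟩ ⟨y, -, hyV⟩
    obtain ⟨_, ⟨F, ⟨hF, hF'⟩, rfl⟩, hxF, hFU⟩ := hbasis.exists_subset_of_mem_open hxU hU
    obtain ⟨_, ⟨F', ⟨hF1, hF1'⟩, rfl⟩, hyF, hFV⟩ := hbasis.exists_subset_of_mem_open hyV hV
    obtain ⟨z, hz⟩ := h.sInter_nonempty (hF.union hF1)
      (fun W hW => hW.elim (fun hW => hF' hW) (fun hW => hF1' hW))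
      (fun W hW => hW.elim (fun hW => ⟨x, hxF W hW⟩) (fun hW => ⟨y, hyF W hW⟩))
    rw [Set.sInter_union] at hz
    exact ⟨z, Set.mem_univ z, hFU hz.1, hFV hz.2⟩
  have : PreconnectedSpace G := inferInstance
  exact { toNonempty := ⟨0⟩ }

theorem MultiplesTrivialOrInfinite.aleph0_le_leadingInvariant {G : Type u} [AddCommGroup G]
    (h : MultiplesTrivialOrInfinite G) (D : UlmKaplanskyDecomposition G) {p : ℕ}
    (hp : p ∈ D.primes) : Cardinal.aleph0 ≤ D.leadingInvariant p := by
  classical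
  by_contra hlt
  have hfin : Finite (D.index p (D.top p)) := by
    rw [← Cardinal.lt_aleph0_iff_finite]; exact not_le.1 hlt
  have hpp := D.prime_of_mem p hp
  have h1p := D.one_le_top p hp
  let t : Finset.Icc 1 (D.top p) := ⟨D.top p, Finset.mem_Icc.2 ⟨h1p, le_rfl⟩⟩
  let T : D.index p (D.top p) → D.Summand := fun x => ⟨⟨p, hp⟩, t, x⟩
  -- Multiplication by `N` kills every summand outside the leading `p`-block but not the summands in
  -- it; if that block is finite, `NG` is finite and nonzero.
  let N : ℕ := p ^ (D.top p - 1) * ∏ q ∈ D.primes.erase p, q ^ D.top q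
  have hN : ∀ s : D.Summand, s ∉ Set.range T → ((s.1 : ℕ) ^ (s.2.1 : ℕ)) ∣ N := by
    rintro ⟨⟨q, hq⟩, ⟨i, hi⟩, x⟩ hs
    have hi' := Finset.mem_Icc.1 hi
    change q ^ i ∣ N
    by_cases hqp : q = p
    · subst hqp
      have hit : i ≠ D.top q := by
        rintro rfl
        exact hs ⟨x, rfl⟩
      refine (pow_dvd_pow _ ?_).trans (Dvd.intro _ rfl)
      have : i ≤ D.top q := hi'.2
      omega
    · refine ((pow_dvd_pow _ hi'.2).trans ?_).trans (Dvd.intro_left _ rfl)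
      exact Finset.dvd_prod_of_mem (fun q => q ^ D.top q) (Finset.mem_erase.2 ⟨hqp, hq⟩)
  have hN' : ¬ p ^ D.top p ∣ N := by
    intro hd
    have h2 : p ^ D.top p = p ^ (D.top p - 1) * p := by
      rw [← pow_succ]; congr 1; omega
    rw [h2] at hd
    have h3 := Nat.dvd_of_mul_dvd_mul_left (pow_pos hpp.pos _) hd
    obtain ⟨q, hq, hpq⟩ := (hpp.prime.dvd_finsetProd_iff _).1 h3
    rw [Finset.mem_erase] at hq
    exact hq.1 ((Nat.prime_dvd_prime_iff_eq hpp (D.prime_of_mem q hq.2)).1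
      (hpp.dvd_of_dvd_pow hpq)).symm
  rcases h N with h0 | hinf
  · obtain ⟨x⟩ := D.nonempty_index_top p hp
    have h1 := h0 (D.equivDirectSum.symm (DirectSum.of
      (fun s : D.Summand => ZMod ((s.1 : ℕ) ^ (s.2.1 : ℕ))) (T x) 1))
    rw [← map_zsmul, map_eq_zero_iff _ (AddEquiv.injective _), ← map_zsmul,
      map_eq_zero_iff _ (DirectSum.of_injective _), zsmul_one, Int.cast_natCast,
      ZMod.natCast_eq_zero_iff] at h1
    exact hN' h1
  · apply hinf
    have hne : ∀ s : Set.range T, NeZero (((s : D.Summand).1 : ℕ) ^ ((s : D.Summand).2.1 : ℕ)) :=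
      fun s => ⟨pow_ne_zero _ (D.prime_of_mem _ (s : D.Summand).1.2).ne_zero⟩
    refine Set.Finite.of_injOn (f := fun y (s : Set.range T) => D.equivDirectSum y s)
      (t := (Set.univ : Set (∀ s : Set.range T,
        ZMod (((s : D.Summand).1 : ℕ) ^ ((s : D.Summand).2.1 : ℕ)))))
      (fun _ _ => Set.mem_univ _) ?_ Set.finite_univ
    rintro _ ⟨y, rfl⟩ _ ⟨z, rfl⟩ hyz
    apply D.equivDirectSum.injective
    refine DFinsupp.ext fun s => ?_
    by_cases hs : s ∈ Set.range T
    · exact congrFun hyz ⟨s, hs⟩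
    · have hz : ∀ w : G, D.equivDirectSum ((N : ℤ) • w) s = 0 := by
        intro w
        rw [map_zsmul]
        change (N : ℤ) • (D.equivDirectSum w s) = 0
        rw [zsmul_eq_mul, Int.cast_natCast, (ZMod.natCast_eq_zero_iff _ _).2 (hN s hs), zero_mul]
      exact (hz y).trans (hz z).symm

theorem theorem3p2 (G : Type u) [AddCommGroup G]
    (hG : ∃ n : ℕ, 1 ≤ n ∧ ∀ g : G, n • g = 0) :
    Nonempty (UlmKaplanskyDecomposition G) ∧
      ∀ D : UlmKaplanskyDecomposition G,
        List.TFAE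
          [AdmitsMinAPGroupTopology G,
           IsZariskiConnected G,
           ∀ p ∈ D.primes, Cardinal.aleph0 ≤ D.leadingInvariant p] := by
  obtain ⟨n, hn, hG⟩ := hG
  refine ⟨nonempty_ulmKaplanskyDecomposition (by omega) hG, fun D => ?_⟩
  tfae_have 1 → 2 := fun h => h.multiplesTrivialOrInfinite.isZariskiConnected
  tfae_have 2 → 3 := fun h p hp => h.multiplesTrivialOrInfinite.aleph0_le_leadingInvariant D hp
  tfae_have 3 → 1 := D.admitsMinAPGroupTopology
  tfae_finish
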